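/- Let $\tau$ be a separation system, that is, a partially ordered set with an order-reversing involution $s\mapsto s^*$. Call $s\in\tau$ \emph{degenerate} if $s=s^*$, \emph{small} if $s\le s^*$, and \emph{trivial} if there is $r\in\tau$ with $s<r$ and $s<r^*$. The system $\tau$ is \emph{nested} if for all $r,s\in\tau$ some element of $\{r,r^*\}$ is comparable with some element of $\{s,s^*\}$; it is a \emph{tree set} if it is nested and has no degenerate and no trivial elements; it is \emph{regular} if it has no small elements. For $r,s\in\tau$ write $r\lneqq s$ if $r\le s$ and $\{r,r^*\}\ne\{s,s^*\}$. A \emph{star} is a set $\sigma\subseteq\tau$ of nondegenerate elements with $r\le s^*$ for all distinct $r,s\in\sigma$. An \emph{orientation} of $\tau$ is a set $O\subseteq\tau$ containing exactly one element of each set $\{s,s^*\}$; it is \emph{consistent} if there are no $r\lneqq s$ with $r^*,s\in O$. A star $\sigma$ is \emph{splitting} if $\tau$ has a consistent orientation $O$ such that $\sigma$ is the set of maximal elements of $O$ and every element of $O$ lies below some element of $\sigma$. A tree set $\tau$ is \emph{chain-complete} if every non-empty chain in $\tau$ has a supremum in $\tau$; \emph{splittable} if for all $r\lneqq s$ in $\tau$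 there are a splitting star $\sigma$ and $r',s'\in\tau$ with $r',(s')^*\in\sigma$ and $r\le r'\lneqq s'\le s$; and \emph{star-finite} if it contains no infinite star. It is \emph{profinite} if it is isomorphic to the inverse limit of an inverse system of finite separation systems indexed by a non-empty directed partially ordered set, where homomorphisms (in particular the bonding maps) are the order-preserving maps that commute with the involutions, an isomorphism is a bijective homomorphism whose inverse is a homomorphism, and the inverse limit carries the coordinatewise order and involution. \textbf{Theorem.} A regular tree set is profinite if and only if it is chain-complete, splittable and star-finite. -/

import Mathlib

universe u v w

/-- A separation system: a partially ordered set (of oriented separations) with an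
order-reversing involution `inv`. The underlying unoriented separation of `s` is `{s, inv s}`. -/
class SeparationSystem (S : Type u) extends PartialOrder S where
  inv : S → S
  inv_inv : ∀ s, inv (inv s) = s
  inv_le_inv : ∀ {r s : S}, r ≤ s → inv s ≤ inv r

namespace SeparationSystem

section Basic

variable {S : Type u} [SeparationSystem S]

/-- The oriented separations `r` and `s` are orientations of the same unoriented separation. -/
def SameSep (r s : S) : Prop := r = s ∨ r = inv s

/-- `r ≤ s`, and the underlying unoriented separations are distinct. -/
def SLt (r s : S) : Prop := r ≤ s ∧ ¬ SameSep r s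

def IsDegenerate (s : S) : Prop := s = inv s

def IsSmall (s : S) : Prop := s ≤ inv s

/-- `r` is trivial if some separation `s` satisfies `r < s` and `r < inv s`. -/
def IsTrivialSep (r : S) : Prop := ∃ s : S, r < s ∧ r < inv s

/-- Two separations are nested if they have comparable orientations. -/
def Nested (r s : S) : Prop := r ≤ s ∨ r ≤ inv s ∨ inv r ≤ s ∨ inv r ≤ inv s

variable (S) in
/-- A tree set: a nested separation system without degenerate or trivial elements. -/
structure IsTreeSet : Prop where
  nested : ∀ r s : S, Nested r s
  not_degenerate : ∀ s : S, ¬ IsDegenerate s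
  not_trivial : ∀ s : S, ¬ IsTrivialSep s

variable (S) in
/-- A separation system is regular if it has no small elements. -/
def IsRegular : Prop := ∀ s : S, ¬ IsSmall s

variable (S) in
/-- Every non-empty chain has a supremum. -/
def IsChainComplete : Prop :=
  ∀ C : Set S, C.Nonempty → IsChain (· ≤ ·) C → ∃ s : S, IsLUB C s

/-- A star: a set of nondegenerate oriented separations that point towards each other. -/
def IsStar (σ : Set S) : Prop :=
  (∀ s ∈ σ, ¬ IsDegenerate s) ∧ ∀ r ∈ σ, ∀ s ∈ σ, r ≠ s → r ≤ inv s

variable (S) in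
/-- There is no infinite star. -/
def IsStarFinite : Prop := ∀ σ : Set S, IsStar σ → σ.Finite

/-- An orientation contains exactly one element of each set `{s, inv s}`. -/
def IsOrientation (O : Set S) : Prop :=
  (∀ s : S, s ∈ O ∨ inv s ∈ O) ∧ ∀ s : S, s ∈ O → inv s ∈ O → s = inv s

/-- No two distinct unoriented separations have orientations `r < s` with `inv r, s ∈ O`. -/
def IsConsistent (O : Set S) : Prop := ∀ r s : S, SLt r s → ¬ (inv r ∈ O ∧ s ∈ O)

/-- `σ` splits the system if it is the set of maximal elements of some consistent orientation
that is contained in the down-closure of `σ`. -/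
def Splits (σ : Set S) : Prop :=
  ∃ O : Set S, IsOrientation O ∧ IsConsistent O ∧
    O ⊆ (lowerClosure σ : Set S) ∧ σ = {s | Maximal (· ∈ O) s}

def IsSplittingStar (σ : Set S) : Prop := IsStar σ ∧ Splits σ

variable (S) in
/-- Between any `r ≤ s` with distinct underlying separations there is a splitting star. -/
def IsSplittable : Prop :=
  ∀ r s : S, SLt r s → ∃ σ : Set S, IsSplittingStar σ ∧
    ∃ r' s' : S, r' ∈ σ ∧ inv s' ∈ σ ∧ r ≤ r' ∧ SLt r' s' ∧ s' ≤ s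

end Basic

/-- A homomorphism commutes with the involutions and respects the orderings. -/
structure Hom (S : Type u) (T : Type v) [SeparationSystem S] [SeparationSystem T] where
  toFun : S → T
  map_inv : ∀ s, toFun (inv s) = inv (toFun s)
  map_le : ∀ {r s : S}, r ≤ s → toFun r ≤ toFun s

/-- An isomorphism is a bijective homomorphism whose inverse is a homomorphism. -/
structure Iso (S : Type u) (T : Type v) [SeparationSystem S] [SeparationSystem T] where
  hom : Hom S T
  invHom : Hom T S
  left_inv : ∀ s, invHom.toFun (hom.toFun s) = s
  right_inv : ∀ t, hom.toFun (invHom.toFun t) = t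

/-- An inverse system of separation systems indexed by the poset `P`: the bonding maps are
homomorphisms, and they are compatible. -/
structure InverseSystem (P : Type v) [PartialOrder P] where
  obj : P → Type w
  sys : ∀ p, SeparationSystem (obj p)
  bond : ∀ {p q : P}, p ≤ q → Hom (obj q) (obj p)
  bond_refl : ∀ (p : P) (x : obj p), (bond (le_refl p)).toFun x = x
  bond_trans : ∀ {p q r : P} (hpq : p ≤ q) (hqr : q ≤ r) (x : obj r),
    (bond hpq).toFun ((bond hqr).toFun x) = (bond (hpq.trans hqr)).toFun x

namespace InverseSystem

variable {P : Type v} [PartialOrder P] (F : InverseSystem.{v, w} P)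

instance (p : P) : SeparationSystem (F.obj p) := F.sys p

/-- The underlying set of the inverse limit: the compatible choices `(x p ∣ p ∈ P)`. -/
def Limit : Type (max v w) :=
  {x : ∀ p, F.obj p // ∀ {p q : P} (h : p ≤ q), (F.bond h).toFun (x q) = x p}

/-- The inverse limit is a separation system with coordinatewise order and involution. -/
instance : SeparationSystem F.Limit where
  le x y := ∀ p, x.1 p ≤ y.1 p
  le_refl x p := le_refl (x.1 p)
  le_trans x y z h h' p := (h p).trans (h' p)
  le_antisymm x y h h' := Subtype.ext (funext fun p => le_antisymm (h p) (h' p))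
  inv x := ⟨fun p => inv (x.1 p), fun {p q} h => by rw [(F.bond h).map_inv, x.2 h]⟩
  inv_inv x := Subtype.ext (funext fun p => SeparationSystem.inv_inv (x.1 p))
  inv_le_inv h p := SeparationSystem.inv_le_inv (h p)

end InverseSystem

/-- A separation system is profinite if it is (isomorphic to) the inverse limit of an inverse
system of finite separation systems indexed by a non-empty directed poset. -/
def IsProfinite (S : Type u) [SeparationSystem S] : Prop :=
  ∃ (P : Type u) (_ : PartialOrder P) (_ : Nonempty P) (_ : IsDirectedOrder P)
    (F : InverseSystem.{u, u} P), (∀ p, Finite (F.obj p)) ∧ Nonempty (Iso S F.Limit)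

end SeparationSystem

namespace SeparationSystem

/-! ### Order and splitting orientations in regular tree sets -/

section RegularTreeSet

variable {S : Type u} [SeparationSystem S]

/-! Both directions are compactness arguments with ultrafilters. A splitting orientation `O` is
down-closed and picks one element of each inverse pair, so `s ↦ (s ∉ O)` is a homomorphism to a
two-element system. Finite families of these give finite quotients, hence a map to their inverse
limit. It reflects the order because splitting orientations separate
(`exists_isSplitOrientation_of_not_le`): this uses splittability, and chain-completeness for maximal
elements. It is onto because every ultrafilter converges (`exists_limit_of_ultrafilter`): by
star-finiteness it settles below one maximal element of `O`, up to inversion, and a supremum then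
provides the limit. Conversely, in a profinite system ultrafilters converge coordinatewise
(`IsCompactlyOrdered`). Limits along chains are suprema, and a limit along an infinite star would be
small. For `r < s`, cutting the interval at a coordinate that separates the two yields a covering
pair (`exists_covBy`), and the orientation towards its lower element splits. -/

lemma inv_le_of_inv_le {r s : S} (h : inv r ≤ s) : inv s ≤ r := by
  simpa only [inv_inv] using inv_le_inv h

lemma le_inv_of_le_inv {r s : S} (h : r ≤ inv s) : s ≤ inv r := by
  simpa only [inv_inv] using inv_le_inv h

lemma le_of_inv_le_inv {r s : S} (h : inv r ≤ inv s) : s ≤ r := by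
  simpa only [inv_inv] using inv_le_inv h

lemma IsRegular.not_le_inv (hreg : IsRegular S) {s : S} : ¬ s ≤ inv s := hreg s

lemma IsRegular.not_inv_le (hreg : IsRegular S) {s : S} : ¬ inv s ≤ s := fun h =>
  hreg (inv s) (by simpa only [IsSmall, inv_inv] using h)

lemma IsRegular.sLt_iff_lt (hreg : IsRegular S) {r s : S} : SLt r s ↔ r < s := by
  constructor
  · rintro ⟨h, hn⟩
    exact lt_of_le_of_ne h fun e => hn (Or.inl e)
  · intro h
    refine ⟨h.le, ?_⟩
    rintro (e | e)
    · exact h.ne e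
    · exact hreg.not_inv_le (e ▸ h.le)

/-- In a regular tree set no separation lies below both orientations of another one. -/
lemma IsTreeSet.not_le_le_inv (hτ : IsTreeSet S) (hreg : IsRegular S) {r s : S}
    (h : r ≤ s) (h' : r ≤ inv s) : False := by
  refine hτ.not_trivial r ⟨s, lt_of_le_of_ne h ?_, lt_of_le_of_ne h' ?_⟩
  · rintro rfl
    exact hreg.not_le_inv h'
  · rintro rfl
    exact hreg.not_inv_le h

lemma IsTreeSet.not_le_inv_le (hτ : IsTreeSet S) (hreg : IsRegular S) {r s : S}
    (h : r ≤ s) (h' : inv r ≤ s) : False :=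
  hτ.not_le_le_inv hreg (inv_le_of_inv_le h') (inv_le_inv h)

/-- The separations in an interval are pairwise comparable. -/
lemma IsTreeSet.le_or_le (hτ : IsTreeSet S) (hreg : IsRegular S) {a b x y : S}
    (hax : a ≤ x) (hay : a ≤ y) (hxb : x ≤ b) (hyb : y ≤ b) : x ≤ y ∨ y ≤ x := by
  rcases hτ.nested x y with h | h | h | h
  · exact Or.inl h
  · exact (hτ.not_le_le_inv hreg hay (hax.trans h)).elim
  · exact (hτ.not_le_inv_le hreg hxb (h.trans hyb)).elim
  · exact Or.inr (le_of_inv_le_inv h)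

lemma IsOrientation.not_inv_mem (hτ : IsTreeSet S) {O : Set S} (hO : IsOrientation O) {s : S}
    (h : s ∈ O) : inv s ∉ O := fun h' => hτ.not_degenerate s (hO.2 s h h')

lemma IsConsistent.mem_of_le (hreg : IsRegular S) {O : Set S} (hO : IsOrientation O)
    (hc : IsConsistent O) {x y : S} (hxy : x ≤ y) (hy : y ∈ O) : x ∈ O := by
  rcases hxy.eq_or_lt with rfl | hlt
  · exact hy
  · exact (hO.1 x).resolve_right fun hx => hc x y (hreg.sLt_iff_lt.2 hlt) ⟨hx, hy⟩

lemma isConsistent_of_isLowerSet (hτ : IsTreeSet S) {O : Set S} (hO : IsOrientation O)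
    (hl : IsLowerSet O) : IsConsistent O := fun _ _ h hm =>
  hO.not_inv_mem hτ (hl h.1 hm.2) hm.1

/-- A consistent orientation whose elements all lie below maximal elements. -/
structure IsSplitOrientation (O : Set S) : Prop where
  orientation : IsOrientation O
  consistent : IsConsistent O
  subset : O ⊆ (lowerClosure {s | Maximal (· ∈ O) s} : Set S)

lemma IsSplitOrientation.isStar (hτ : IsTreeSet S) {O : Set S} (hO : IsSplitOrientation O)
    (hreg : IsRegular S) : IsStar {s | Maximal (· ∈ O) s} := by
  refine ⟨fun s _ => hτ.not_degenerate s, fun r hr s hs hne => ?_⟩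
  rcases hτ.nested r s with h | h | h | h
  · exact (hne (hr.eq_of_le hs.prop h)).elim
  · exact h
  · exact (hO.orientation.not_inv_mem hτ hr.prop
      (hO.consistent.mem_of_le hreg hO.orientation h hs.prop)).elim
  · exact (hne (hs.eq_of_le hr.prop (le_of_inv_le_inv h)).symm).elim

lemma IsSplitOrientation.isSplittingStar (hτ : IsTreeSet S) {O : Set S}
    (hO : IsSplitOrientation O) (hreg : IsRegular S) :
    IsSplittingStar {s | Maximal (· ∈ O) s} :=
  ⟨hO.isStar hτ hreg, O, hO.orientation, hO.consistent, hO.subset, rfl⟩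

lemma Splits.exists_isSplitOrientation {σ : Set S} (h : Splits σ) :
    ∃ O, IsSplitOrientation O ∧ σ ⊆ O := by
  obtain ⟨O, hO, hc, hsub, rfl⟩ := h
  exact ⟨O, ⟨hO, hc, hsub⟩, fun s hs => hs.prop⟩

/-- The principal ideal of a maximal separation is a splitting orientation. -/
lemma isSplitOrientation_Iic (hτ : IsTreeSet S) (hreg : IsRegular S) {m : S} (hm : IsMax m) :
    IsSplitOrientation (Set.Iic m) := by
  have hO : IsOrientation (Set.Iic m) := by
    refine ⟨fun s => ?_, fun s hs hs' => (hτ.not_le_inv_le hreg hs hs').elim⟩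
    rcases hτ.nested s m with h | h | h | h
    · exact Or.inl h
    · exact Or.inr (hm (le_inv_of_le_inv h))
    · exact Or.inr h
    · exact Or.inl (hm (le_of_inv_le_inv h))
  exact ⟨hO, isConsistent_of_isLowerSet hτ hO (isLowerSet_Iic m), fun s hs =>
    ⟨m, ⟨le_refl m, fun _ h _ => h⟩, hs⟩⟩

lemma IsChainComplete.exists_isSplitOrientation_mem (hτ : IsTreeSet S) (hreg : IsRegular S)
    (hcc : IsChainComplete S) (x : S) : ∃ O, IsSplitOrientation O ∧ x ∈ O := by
  obtain ⟨m, hxm, hm⟩ := zorn_le_nonempty_Ici₀ x (fun c _ hc y hy => by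
    obtain ⟨s, hs⟩ := hcc c ⟨y, hy⟩ hc
    exact ⟨s, hs.1⟩) x le_rfl
  exact ⟨_, isSplitOrientation_Iic hτ hreg hm, hxm⟩

/-- The splitting orientations separate the order. -/
lemma exists_isSplitOrientation_of_not_le (hτ : IsTreeSet S) (hreg : IsRegular S)
    (hcc : IsChainComplete S) (hsp : IsSplittable S) {r s : S} (hrs : ¬ r ≤ s) :
    ∃ O, IsSplitOrientation O ∧ inv r ∈ O ∧ s ∈ O := by
  -- Unless `s < r`, one of `inv r` and `s` lies below the other, and any splitting orientation
  -- containing the larger one will do.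
  rcases hτ.nested r s with h | h | h | h
  · exact (hrs h).elim
  · obtain ⟨O, hO, hr⟩ := hcc.exists_isSplitOrientation_mem hτ hreg (inv r)
    exact ⟨O, hO, hr, hO.consistent.mem_of_le hreg hO.orientation (le_inv_of_le_inv h) hr⟩
  · obtain ⟨O, hO, hs⟩ := hcc.exists_isSplitOrientation_mem hτ hreg s
    exact ⟨O, hO, hO.consistent.mem_of_le hreg hO.orientation h hs, hs⟩
  · have hlt : s < r := lt_of_le_not_ge (le_of_inv_le_inv h) hrs
    obtain ⟨σ, ⟨_, hσ⟩, s', r', hs', hr', hss', _, hrr'⟩ := hsp s r (hreg.sLt_iff_lt.2 hlt)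
    obtain ⟨O, hO, hsub⟩ := hσ.exists_isSplitOrientation
    exact ⟨O, hO, hO.consistent.mem_of_le hreg hO.orientation (inv_le_inv hrr') (hsub hr'),
      hO.consistent.mem_of_le hreg hO.orientation hss' (hsub hs')⟩

/-! ### Convergence of ultrafilters -/

/-- Star-finiteness covers `O` by finitely many principal ideals, and an ultrafilter selects one of
them. -/
lemma IsSplitOrientation.exists_eventually_le (hτ : IsTreeSet S) (hreg : IsRegular S)
    (hsf : IsStarFinite S) {O : Set S} (hO : IsSplitOrientation O) {ι : Type*} (U : Ultrafilter ι)
    (f : ι → S) (h : ∀ᶠ t in U, f t ∈ O) : ∃ a ∈ O, ∀ᶠ t in U, f t ≤ a := by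
  have hfin := hsf _ (hO.isStar hτ hreg)
  have : ∀ᶠ t in U, ∃ a ∈ {s | Maximal (· ∈ O) s}, f t ≤ a := by
    filter_upwards [h] with t ht using hO.subset ht
  obtain ⟨a, ha, hle⟩ := (Ultrafilter.eventually_exists_mem_iff hfin).1 this
  exact ⟨a, ha.prop, hle⟩

lemma IsChainComplete.exists_isGLB (hcc : IsChainComplete S) {C : Set S} (hne : C.Nonempty)
    (hC : IsChain (· ≤ ·) C) : ∃ s, IsGLB C s := by
  obtain ⟨x, hx⟩ := hne
  obtain ⟨s, hs⟩ := hcc (inv '' C) ⟨_, x, hx, rfl⟩ (by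
    rintro _ ⟨y, hy, rfl⟩ _ ⟨z, hz, rfl⟩ _
    exact (hC.total hz hy).imp inv_le_inv inv_le_inv)
  refine ⟨inv s, fun y hy => inv_le_of_inv_le (hs.1 ⟨y, hy, rfl⟩), fun b hb =>
    le_inv_of_le_inv (hs.2 ?_)⟩
  rintro _ ⟨y, hy, rfl⟩
  exact inv_le_inv (hb hy)

lemma IsStar.exists_maximal {σ : Set S} (hσ : IsStar σ) :
    ∃ ρ, σ ⊆ ρ ∧ Maximal IsStar ρ := by
  refine zorn_subset_nonempty {ρ | IsStar ρ} (fun c hc hchain _ => ⟨⋃₀ c, ⟨?_, ?_⟩, fun s hs =>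
    Set.subset_sUnion_of_mem hs⟩) σ hσ
  · rintro s ⟨ρ, hρ, hs⟩
    exact (hc hρ).1 s hs
  · rintro r ⟨ρ, hρ, hr⟩ s ⟨ρ', hρ', hs⟩ hne
    rcases hchain.total hρ hρ' with h | h
    · exact (hc hρ').2 r (h hr) s hs hne
    · exact (hc hρ).2 r hr s (h hs) hne

/-- The separations that lie eventually below an ultrafilter form a directed set. -/
lemma directedOn_eventually_le (hτ : IsTreeSet S) (hreg : IsRegular S)
    (hcc : IsChainComplete S) (hsf : IsStarFinite S) {ι : Type*} (U : Ultrafilter ι) (f : ι → S) :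
    DirectedOn (· ≤ ·) {s | ∀ᶠ t in U, s ≤ f t} := by
  intro a ha c hc
  by_cases hac : a ≤ c
  · exact ⟨c, hc, hac, le_rfl⟩
  by_cases hca : c ≤ a
  · exact ⟨a, ha, le_rfl, hca⟩
  have hac' : a ≤ inv c := by
    obtain ⟨t, hat, hct⟩ := (ha.and hc).exists
    rcases hτ.nested a c with h | h | h | h
    · exact (hac h).elim
    · exact h
    · exact (hτ.not_le_inv_le hreg hat (h.trans hct)).elim
    · exact (hca (le_of_inv_le_inv h)).elim
  have hstar : IsStar {a, c} := by
    refine ⟨fun s _ => hτ.not_degenerate s, ?_⟩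
    rintro r (rfl | rfl) s (rfl | rfl) hne
    · exact (hne rfl).elim
    · exact hac'
    · exact le_inv_of_le_inv hac'
    · exact (hne rfl).elim
  obtain ⟨ρ, hsub, hρ⟩ := hstar.exists_maximal
  have haρ : a ∈ ρ := hsub (Or.inl rfl)
  have hcρ : c ∈ ρ := hsub (Or.inr rfl)
  -- If all of `ρ` lay below `f t`, maximality would put `inv (f t)` into `ρ`, and so below `f t`,
  -- against regularity.
  have hex : ∀ᶠ t in U, ∃ b ∈ ρ, ¬ b ≤ f t := by
    refine Filter.Eventually.of_forall fun t => ?_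
    by_contra! hall
    have hins : IsStar (insert (inv (f t)) ρ) := by
      refine ⟨fun s _ => hτ.not_degenerate s, ?_⟩
      rintro r (rfl | hr) s (rfl | hs) hne
      · exact (hne rfl).elim
      · exact inv_le_inv (hall s hs)
      · rw [inv_inv]
        exact hall r hr
      · exact hρ.prop.2 r hr s hs hne
    exact hreg.not_inv_le (hall _ (hρ.le_of_ge hins (Set.subset_insert _ _) (Set.mem_insert _ _)))
  obtain ⟨b, hb, hbt⟩ := (Ultrafilter.eventually_exists_mem_iff (hsf ρ hρ.prop)).1 hex
  have hab : a ≤ inv b := hρ.prop.2 a haρ b hb <| by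
    rintro rfl
    obtain ⟨t, h, h'⟩ := (ha.and hbt).exists
    exact h' h
  have hcb : c ≤ inv b := hρ.prop.2 c hcρ b hb <| by
    rintro rfl
    obtain ⟨t, h, h'⟩ := (hc.and hbt).exists
    exact h' h
  have hor : ∀ᶠ t in U, inv b ≤ f t ∨ f t ≤ inv b := by
    filter_upwards [ha, hbt] with t hat hbt
    rcases hτ.nested b (f t) with h | h | h | h
    · exact (hbt h).elim
    · exact Or.inr (le_inv_of_le_inv h)
    · exact Or.inl h
    · exact (hτ.not_le_le_inv hreg (hat.trans (le_of_inv_le_inv h)) hab).elim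
  rcases Ultrafilter.eventually_or.1 hor with h | h
  · exact ⟨inv b, h, hab, hcb⟩
  -- Now the values are eventually trapped in an interval, which is a chain; its infimum is the
  -- required bound.
  · have hT : ∀ᶠ t in U, f t ∈ {x | a ≤ x ∧ c ≤ x ∧ x ≤ inv b} := by
      filter_upwards [ha, hc, h] with t h1 h2 h3 using ⟨h1, h2, h3⟩
    obtain ⟨t, ht⟩ := hT.exists
    obtain ⟨z, hz⟩ := hcc.exists_isGLB ⟨f t, ht⟩ fun x hx y hy _ =>
      hτ.le_or_le hreg hx.1 hy.1 hx.2.2 hy.2.2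
    exact ⟨z, hT.mono fun t ht => hz.1 ht, hz.2 fun x hx => hx.1, hz.2 fun x hx => hx.2.1⟩

/-- If an ultrafilter lies eventually above some separation, it converges with respect to the
splitting orientations. -/
lemma exists_limit_of_eventually_le (hτ : IsTreeSet S) (hreg : IsRegular S)
    (hcc : IsChainComplete S) (hsf : IsStarFinite S) {ι : Type*} (U : Ultrafilter ι) (f : ι → S)
    {a : S} (ha : ∀ᶠ t in U, a ≤ f t) :
    ∃ m, ∀ O, IsSplitOrientation O → (m ∈ O ↔ ∀ᶠ t in U, f t ∈ O) := by
  -- Only elements above `a` are taken, to obtain a chain; directedness makes its supremum bound all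
  -- the others too.
  have hchain : IsChain (· ≤ ·) {s | a ≤ s ∧ ∀ᶠ t in U, s ≤ f t} := by
    intro x hx y hy _
    obtain ⟨t, hxt, hyt⟩ := (hx.2.and hy.2).exists
    exact hτ.le_or_le hreg hx.1 hy.1 hxt hyt
  obtain ⟨m, hm⟩ := hcc {s | a ≤ s ∧ ∀ᶠ t in U, s ≤ f t} ⟨a, le_rfl, ha⟩ hchain
  have hle : ∀ c, (∀ᶠ t in U, c ≤ f t) → c ≤ m := fun c hc => by
    obtain ⟨z, hz, haz, hcz⟩ := directedOn_eventually_le hτ hreg hcc hsf U f a ha c hc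
    exact hcz.trans (hm.1 ⟨haz, hz⟩)
  refine ⟨m, fun O hO => ⟨fun hmO => ?_, fun h => ?_⟩⟩
  · by_contra hn
    have hn' : ∀ᶠ t in U, inv (f t) ∈ O := by
      filter_upwards [Ultrafilter.eventually_not.2 hn] with t ht
      exact (hO.orientation.1 _).resolve_left ht
    obtain ⟨b, hb, hbt⟩ := hO.exists_eventually_le hτ hreg hsf U _ hn'
    have hbm : inv b ≤ m := hle _ (hbt.mono fun t ht => inv_le_of_inv_le ht)
    exact hO.orientation.not_inv_mem hτ hb
      (hO.consistent.mem_of_le hreg hO.orientation hbm hmO)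
  · obtain ⟨b, hb, hle⟩ := hO.exists_eventually_le hτ hreg hsf U f h
    refine hO.consistent.mem_of_le hreg hO.orientation (hm.2 fun s hs => ?_) hb
    obtain ⟨t, hst, htb⟩ := (hs.2.and hle).exists
    exact hst.trans htb

/-- Every ultrafilter converges with respect to the splitting orientations. -/
lemma exists_limit_of_ultrafilter (hτ : IsTreeSet S) (hreg : IsRegular S)
    (hcc : IsChainComplete S) (hsf : IsStarFinite S) (U : Ultrafilter S) :
    ∃ m, ∀ O, IsSplitOrientation O → (m ∈ O ↔ O ∈ U) := by
  obtain ⟨x⟩ := U.neBot.nonempty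
  obtain ⟨O, hO, -⟩ := hcc.exists_isSplitOrientation_mem hτ hreg x
  have inv_mem : ∀ O : Set S, IsSplitOrientation O → ∀ s, inv s ∈ O ↔ s ∉ O := fun O hO s =>
    ⟨fun h h' => hO.orientation.not_inv_mem hτ h' h, (hO.orientation.1 s).resolve_left⟩
  -- Either `U` is eventually bounded below, or its image under `inv` is.
  by_cases h : ∀ᶠ t in U, t ∈ O
  · obtain ⟨b, -, hle⟩ := hO.exists_eventually_le hτ hreg hsf U _ h
    obtain ⟨m, hm⟩ := exists_limit_of_eventually_le hτ hreg hcc hsf U inv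
      (hle.mono fun t ht => inv_le_inv ht)
    refine ⟨inv m, fun O' hO' => ?_⟩
    rw [inv_mem O' hO', hm O' hO']
    simp only [inv_mem O' hO', Ultrafilter.eventually_not, not_not]
    rfl
  · have h' : ∀ᶠ t in U, inv t ∈ O := by
      simpa only [inv_mem O hO, Ultrafilter.eventually_not] using h
    obtain ⟨b, -, hle⟩ := hO.exists_eventually_le hτ hreg hsf U _ h'
    exact exists_limit_of_eventually_le hτ hreg hcc hsf U id
      (hle.mono fun t ht => inv_le_of_inv_le ht)

end RegularTreeSet

/-! ### The inverse system of traces -/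

section Construction

variable {S : Type u} [SeparationSystem S]

variable (S) in
/-- The type of splitting orientations. -/
abbrev SplitOrientation : Type u := {O : Set S // IsSplitOrientation O}

open Classical in
/-- The pattern in which `s` lies outside the splitting orientations of a finite set. -/
noncomputable def trace (p : Finset (SplitOrientation S)) (s : S) : p → Bool :=
  -- As `O` is down-closed, non-membership is the monotone choice.
  fun O => decide (s ∉ O.1.1)

lemma trace_apply_eq_iff {p : Finset (SplitOrientation S)} {r s : S} {O : p} :
    trace p r O = trace p s O ↔ (r ∈ O.1.1 ↔ s ∈ O.1.1) := by
  rw [trace, trace, decide_eq_decide, not_iff_not]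

lemma trace_inv (hτ : IsTreeSet S) (p : Finset (SplitOrientation S)) (s : S) (O : p) :
    trace p (inv s) O = !trace p s O := by
  have : inv s ∉ O.1.1 ↔ s ∈ O.1.1 :=
    ⟨(O.1.2.orientation.1 s).resolve_right, O.1.2.orientation.not_inv_mem hτ⟩
  by_cases h : s ∈ O.1.1 <;> simp [trace, this, h]

lemma trace_mono (hreg : IsRegular S) (p : Finset (SplitOrientation S)) :
    Monotone (trace (S := S) p) := fun r s hrs O => by
  rw [trace, trace, Bool.le_iff_imp]
  simp only [decide_eq_true_eq]
  exact fun hr hs => hr (O.1.2.consistent.mem_of_le hreg O.1.2.orientation hrs hs)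

/-- The finite separation system of the traces on a finite set of splitting orientations. -/
@[reducible]
noncomputable def traceSystem (hτ : IsTreeSet S) (p : Finset (SplitOrientation S)) :
    SeparationSystem (Set.range (trace (S := S) p)) where
  inv x := ⟨fun O => !x.1 O, by
    obtain ⟨s, hs⟩ := x.2
    exact ⟨inv s, by ext1 O; rw [trace_inv hτ, hs]⟩⟩
  inv_inv x := Subtype.ext (funext fun O => Bool.not_not _)
  inv_le_inv h O := by
    have := h O
    revert this
    simp only [Bool.le_iff_imp, Bool.not_eq_true']
    intro h1 h2
    by_contra h3
    rw [Bool.not_eq_false] at h3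
    rw [h1 h3] at h2
    exact Bool.noConfusion h2

/-- The inverse system of the traces on finite sets of splitting orientations. -/
noncomputable def traceInverseSystem (hτ : IsTreeSet S) :
    InverseSystem.{u, u} (Finset (SplitOrientation S)) where
  obj p := Set.range (trace (S := S) p)
  sys p := traceSystem hτ p
  bond {p q} h :=
    letI := traceSystem hτ p
    letI := traceSystem hτ q
    { toFun := fun x => ⟨fun O => x.1 ⟨O.1, h O.2⟩, by
        obtain ⟨s, hs⟩ := x.2
        exact ⟨s, by ext1 O; rw [← hs]; rfl⟩⟩
      map_inv := fun _ => rfl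
      map_le := fun hle O => hle ⟨O.1, h O.2⟩ }
  bond_refl _ _ := rfl
  bond_trans _ _ _ := rfl

/-- The canonical map into the inverse limit of the traces. -/
noncomputable def toLimit (hτ : IsTreeSet S) (hreg : IsRegular S) :
    Hom S (traceInverseSystem hτ).Limit where
  toFun s := ⟨fun p => ⟨trace p s, s, rfl⟩, fun _ => rfl⟩
  map_inv s := Subtype.ext <| funext fun p => Subtype.ext <| funext fun O => trace_inv hτ p s O
  map_le h p := trace_mono hreg p h

lemma le_of_toLimit_le (hτ : IsTreeSet S) (hreg : IsRegular S) (hcc : IsChainComplete S)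
    (hsp : IsSplittable S) {r s : S}
    (h : (toLimit hτ hreg).toFun r ≤ (toLimit hτ hreg).toFun s) : r ≤ s := by
  by_contra hrs
  obtain ⟨O, hO, hr, hs⟩ := exists_isSplitOrientation_of_not_le hτ hreg hcc hsp hrs
  have hr' : r ∉ O := fun h => hO.orientation.not_inv_mem hτ h hr
  let p : Finset (SplitOrientation S) := {⟨O, hO⟩}
  have h1 : trace p r ≤ trace p s := h p
  have h2 := h1 ⟨⟨O, hO⟩, Finset.mem_singleton_self _⟩
  rw [trace, trace, Bool.le_iff_imp] at h2
  simp only [decide_eq_true_eq] at h2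
  exact h2 hr' hs

lemma toLimit_surjective (hτ : IsTreeSet S) (hreg : IsRegular S) (hcc : IsChainComplete S)
    (hsf : IsStarFinite S) : Function.Surjective (toLimit hτ hreg).toFun := by
  intro x
  have hx : ∀ p, ∃ s, trace p s = (x.1 p).1 := fun p => (x.1 p).2
  choose g hg using hx
  have hcompat : ∀ {p q : Finset (SplitOrientation S)} (h : p ≤ q) (O : p),
      (x.1 p).1 O = (x.1 q).1 ⟨O.1, h O.2⟩ := fun h O =>
    (congrFun (congrArg Subtype.val (x.2 h)) O).symm
  -- Along an ultrafilter containing all tails of finite sets, the realisations `g p` of the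
  -- coordinates of `x` converge to a preimage.
  let U : Ultrafilter S :=
    (Ultrafilter.of (Filter.atTop : Filter (Finset (SplitOrientation S)))).map g
  obtain ⟨m, hm⟩ := exists_limit_of_ultrafilter hτ hreg hcc hsf U
  refine ⟨m, Subtype.ext <| funext fun p => Subtype.ext <| funext fun O => ?_⟩
  have hev : ∀ᶠ q in Ultrafilter.of (Filter.atTop : Filter (Finset (SplitOrientation S))),
      (g q ∈ O.1.1 ↔ g p ∈ O.1.1) := by
    refine Ultrafilter.of_le _ ?_
    filter_upwards [Filter.eventually_ge_atTop p] with q hq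
    rw [← trace_apply_eq_iff (O := O), hg p, hcompat hq O, ← hg q]
    rfl
  change trace p m O = (x.1 p).1 O
  rw [← hg p, trace_apply_eq_iff, hm _ O.1.2]
  exact (Filter.eventually_congr hev).trans Filter.eventually_const

theorem isProfinite_of_isChainComplete (hτ : IsTreeSet S) (hreg : IsRegular S)
    (hcc : IsChainComplete S) (hsp : IsSplittable S) (hsf : IsStarFinite S) :
    IsProfinite S := by
  classical
  refine ⟨Finset (SplitOrientation S), inferInstance, inferInstance, inferInstance,
    traceInverseSystem hτ, fun p => ?_, ?_⟩
  · exact inferInstanceAs (Finite (Set.range (trace (S := S) p)))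
  · have hinj : Function.Injective (toLimit hτ hreg).toFun := fun r s h =>
      le_antisymm (le_of_toLimit_le hτ hreg hcc hsp h.le) (le_of_toLimit_le hτ hreg hcc hsp h.ge)
    let e := Equiv.ofBijective _ ⟨hinj, toLimit_surjective hτ hreg hcc hsf⟩
    have he : ∀ t, (toLimit hτ hreg).toFun (e.symm t) = t := e.apply_symm_apply
    exact ⟨{
      hom := toLimit hτ hreg
      invHom :=
        { toFun := e.symm
          map_inv := fun t => hinj (by rw [(toLimit hτ hreg).map_inv, he, he])
          map_le := fun h => le_of_toLimit_le hτ hreg hcc hsp (by rwa [he, he]) }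
      left_inv := e.symm_apply_apply
      right_inv := he }⟩

end Construction

/-! ### Consequences of profiniteness -/

section Profinite

/-- The order of `α` is induced by monotone maps to posets, with respect to which every
ultrafilter converges. -/
structure IsCompactlyOrdered (α : Type*) [PartialOrder α] {ι : Type*} {X : ι → Type*}
    [∀ i, PartialOrder (X i)] (π : ∀ i, α → X i) : Prop where
  mono : ∀ i, Monotone (π i)
  le_of_forall : ∀ r s, (∀ i, π i r ≤ π i s) → r ≤ s
  exists_limit : ∀ U : Ultrafilter α, ∃ s, ∀ i, ∀ᶠ t in U, π i t = π i s

namespace IsCompactlyOrdered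

variable {α : Type*} [PartialOrder α] {ι : Type*} {X : ι → Type*} [∀ i, PartialOrder (X i)]
  {π : ∀ i, α → X i}

lemma dual (h : IsCompactlyOrdered α π) :
    IsCompactlyOrdered αᵒᵈ (X := fun i => (X i)ᵒᵈ)
      (fun i x => OrderDual.toDual (π i (OrderDual.ofDual x))) where
  mono i _ _ hrs := h.mono i hrs
  le_of_forall r s hrs := h.le_of_forall s r hrs
  exists_limit U := h.exists_limit U

lemma le_of_eventually_ge (h : IsCompactlyOrdered α π) {U : Ultrafilter α} {r s : α}
    (hs : ∀ i, ∀ᶠ t in U, π i t = π i s) (hr : ∀ᶠ t in U, r ≤ t) : r ≤ s := by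
  refine h.le_of_forall r s fun i => ?_
  obtain ⟨t, hts, hrt⟩ := ((hs i).and hr).exists
  exact hts ▸ h.mono i hrt

lemma le_of_eventually_le (h : IsCompactlyOrdered α π) {U : Ultrafilter α} {r s : α}
    (hs : ∀ i, ∀ᶠ t in U, π i t = π i s) (hr : ∀ᶠ t in U, t ≤ r) : s ≤ r :=
  h.dual.le_of_eventually_ge (U := U) (r := OrderDual.toDual r) hs hr

/-- Chains have suprema, which lie in the closure of the chain. -/
lemma exists_isLUB (h : IsCompactlyOrdered α π) {C : Set α} (hne : C.Nonempty)
    (hC : IsChain (· ≤ ·) C) : ∃ s, IsLUB C s ∧ ∀ i, ∃ c ∈ C, π i c = π i s := by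
  have : Nonempty C := hne.to_subtype
  have : IsDirectedOrder C := ⟨fun a b => by
    rcases hC.total a.2 b.2 with hab | hab
    · exact ⟨b, hab, le_rfl⟩
    · exact ⟨a, le_rfl, hab⟩⟩
  -- Each `c ∈ C` is eventually exceeded along `V`, so the limit is an upper bound; bounds of `C`
  -- persist in the limit.
  let V : Ultrafilter C := Ultrafilter.of Filter.atTop
  obtain ⟨s, hs⟩ := h.exists_limit (V.map Subtype.val)
  refine ⟨s, ⟨fun c hc => h.le_of_eventually_ge hs ?_, fun b hb => h.le_of_eventually_le hs ?_⟩,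
    fun i => ?_⟩
  · exact Ultrafilter.of_le Filter.atTop (Filter.eventually_ge_atTop (⟨c, hc⟩ : C))
  · exact Filter.Eventually.of_forall (f := (V : Filter C)) fun c => hb c.2
  · obtain ⟨c, hc⟩ := Filter.Eventually.exists (f := (V : Filter C)) (hs i)
    exact ⟨c, c.2, hc⟩

lemma exists_isGLB (h : IsCompactlyOrdered α π) {C : Set α} (hne : C.Nonempty)
    (hC : IsChain (· ≤ ·) C) : ∃ s, IsGLB C s ∧ ∀ i, ∃ c ∈ C, π i c = π i s :=
  h.dual.exists_isLUB (C := OrderDual.ofDual ⁻¹' C) hne hC.symm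

/-- If the interval between `r < s` is a chain, it contains a covering pair. -/
lemma exists_covBy (h : IsCompactlyOrdered α π) {r s : α} (hrs : r < s)
    (hC : IsChain (· ≤ ·) (Set.Icc r s)) : ∃ r' s', r ≤ r' ∧ r' ⋖ s' ∧ s' ≤ s := by
  obtain ⟨i, hi⟩ : ∃ i, ¬ π i s ≤ π i r := by
    by_contra! hn
    exact hrs.not_ge (h.le_of_forall s r hn)
  -- Coordinate `i` cuts the interval into a lower part, where it still has its value at `r`, and an
  -- upper part. Since the supremum and the infimum attain their coordinates within their parts,
  -- each stays on its side of the cut, leaving nothing between them.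
  have hri : r ∈ {t ∈ Set.Icc r s | π i t = π i r} := ⟨⟨le_rfl, hrs.le⟩, rfl⟩
  have hsi : s ∈ {t ∈ Set.Icc r s | π i t ≠ π i r} := ⟨⟨hrs.le, le_rfl⟩, fun e => hi e.le⟩
  obtain ⟨r', hr', hr'c⟩ := h.exists_isLUB ⟨r, hri⟩ (hC.mono (Set.sep_subset _ _))
  obtain ⟨s', hs', hs'c⟩ := h.exists_isGLB ⟨s, hsi⟩ (hC.mono (Set.sep_subset _ _))
  have hr'i : π i r' = π i r := by
    obtain ⟨c, hc, hci⟩ := hr'c i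
    exact hci ▸ hc.2
  have hs'i : π i s' ≠ π i r := by
    obtain ⟨c, hc, hci⟩ := hs'c i
    exact hci ▸ hc.2
  have hrr' : r ≤ r' := hr'.1 hri
  have hs's : s' ≤ s := hs'.1 hsi
  have hle : r' ≤ s' := by
    refine hr'.2 fun x hx => hs'.2 fun y hy => ?_
    refine (hC.total hx.1 hy.1).resolve_right fun hyx => hy.2 ?_
    exact le_antisymm ((h.mono i hyx).trans hx.2.le) (h.mono i hy.1.1)
  refine ⟨r', s', hrr', ⟨lt_of_le_of_ne hle fun e => hs'i (e ▸ hr'i), fun t ht ht' => ?_⟩, hs's⟩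
  have htm : t ∈ Set.Icc r s := ⟨hrr'.trans ht.le, ht'.le.trans hs's⟩
  by_cases hti : π i t = π i r
  · exact ht.not_ge (hr'.1 ⟨htm, hti⟩)
  · exact ht'.not_ge (hs'.1 ⟨htm, hti⟩)

end IsCompactlyOrdered

variable {S : Type u} [SeparationSystem S]

/-- On finite coordinates an ultrafilter is eventually constant; the constants are compatible
because any two of these events meet, so they form a point of the limit. -/
lemma IsProfinite.exists_isCompactlyOrdered (h : IsProfinite S) :
    ∃ (ι : Type u) (X : ι → Type u) (_ : ∀ i, PartialOrder (X i)) (π : ∀ i, S → X i),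
      IsCompactlyOrdered S π := by
  obtain ⟨P, _, _, _, F, hfin, ⟨e⟩⟩ := h
  refine ⟨P, F.obj, fun p => (F.sys p).toPartialOrder, fun p s => (e.hom.toFun s).1 p,
    fun p r s hrs => e.hom.map_le hrs p, fun r s hrs => ?_, fun U => ?_⟩
  · have := e.invHom.map_le (r := e.hom.toFun r) (s := e.hom.toFun s) hrs
    rwa [e.left_inv, e.left_inv] at this
  · have hx : ∀ p, ∃ x : F.obj p, ∀ᶠ t in U, (e.hom.toFun t).1 p = x := fun p => by
      have := hfin p
      exact Ultrafilter.eventually_exists_iff.1 (Filter.Eventually.of_forall fun t => ⟨_, rfl⟩)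
    choose x hx using hx
    have hcompat : ∀ {p q : P} (h : p ≤ q), (F.bond h).toFun (x q) = x p := by
      intro p q hpq
      obtain ⟨t, hp, hq⟩ := ((hx p).and (hx q)).exists
      rw [← hp, ← hq, (e.hom.toFun t).2 hpq]
    refine ⟨e.invHom.toFun ⟨x, hcompat⟩, fun p => ?_⟩
    have he := congrArg (fun y : F.Limit => y.1 p) (e.right_inv ⟨x, hcompat⟩)
    exact (hx p).mono fun t ht => ht.trans he.symm

/-- A regular, compactly ordered separation system has no infinite star. -/
lemma IsCompactlyOrdered.isStarFinite (hreg : IsRegular S) {ι : Type*} {X : ι → Type*}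
    [∀ i, PartialOrder (X i)] {π : ∀ i, S → X i} (h : IsCompactlyOrdered S π) :
    IsStarFinite S := by
  intro σ hσ
  by_contra hinf
  have : Infinite σ := Set.infinite_coe_iff.2 hinf
  let V : Ultrafilter σ := Filter.hyperfilter σ
  obtain ⟨s, hs⟩ := h.exists_limit (V.map Subtype.val)
  -- A non-principal ultrafilter ignores `t` itself, so the star inequality passes to the limit.
  -- Taking the limit over `t` as well makes `s` small.
  have hle : ∀ t ∈ σ, s ≤ inv t := fun t ht => by
    refine h.le_of_eventually_le hs ?_
    have hne : ∀ᶠ t' in (V : Filter σ), t' ≠ ⟨t, ht⟩ :=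
      (Set.finite_singleton _).compl_mem_hyperfilter
    exact hne.mono fun t' ht' => hσ.2 _ t'.2 _ ht fun e => ht' (Subtype.ext e)
  refine hreg.not_le_inv (h.le_of_eventually_le hs ?_)
  exact Filter.Eventually.of_forall (f := (V : Filter σ)) fun t => le_inv_of_le_inv (hle t t.2)

/-- The orientation of all separations towards the head of `r`. -/
lemma isOrientation_towards (hτ : IsTreeSet S) (hreg : IsRegular S) (r : S) :
    IsOrientation {x | x ≤ r ∨ x < inv r} := by
  constructor
  · intro x
    rcases hτ.nested x r with h | h | h | h
    · exact Or.inl (Or.inl h)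
    · rcases h.eq_or_lt with rfl | h
      · exact Or.inr (Or.inl (inv_inv r).le)
      · exact Or.inl (Or.inr h)
    · exact Or.inr (Or.inl h)
    · rcases h.eq_or_lt with h | h
      · exact Or.inl (Or.inl (le_of_inv_le_inv h.ge))
      · exact Or.inr (Or.inr h)
  · rintro x (hx | hx) (hx' | hx')
    · exact (hτ.not_le_inv_le hreg hx hx').elim
    · exact (hx'.ne (by rw [le_antisymm hx (le_of_inv_le_inv hx'.le)])).elim
    · exact (hx.ne (le_antisymm hx.le (inv_le_of_inv_le hx'))).elim
    · exact (hτ.not_le_inv_le hreg hx.le hx'.le).elim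

/-- The head of `r` is a splitting orientation if `r` is covered by some separation `s`, and the
star at this head contains both `r` and `inv s`. -/
lemma IsChainComplete.isSplitOrientation_of_covBy (hτ : IsTreeSet S) (hreg : IsRegular S)
    (hcc : IsChainComplete S) {r s : S} (hrs : r ⋖ s) :
    ∃ O, IsSplitOrientation O ∧ Maximal (· ∈ O) r ∧ Maximal (· ∈ O) (inv s) := by
  set O : Set S := {x | x ≤ r ∨ x < inv r} with hOdef
  have hO : IsOrientation O := isOrientation_towards hτ hreg r
  have hl : IsLowerSet O := fun y x hxy hy =>
    hy.imp (fun h => hxy.trans h) (fun h => hxy.trans_lt h)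
  have hr : Maximal (· ∈ O) r := by
    refine ⟨Or.inl le_rfl, ?_⟩
    rintro x (hx | hx) hrx
    · exact hx
    · exact (hreg.not_le_inv (hrx.trans hx.le)).elim
  have hs : Maximal (· ∈ O) (inv s) := by
    refine ⟨Or.inr (lt_of_le_not_ge (inv_le_inv hrs.le) fun h =>
      hrs.lt.not_ge (le_of_inv_le_inv h)), ?_⟩
    rintro x (hx | hx) hsx
    · exact (hreg.not_inv_le (hsx.trans (hx.trans hrs.le))).elim
    -- Here `r < inv x ≤ s`, so the covering relation forces `inv x = s`.
    · have h1 : r < inv x := lt_of_le_not_ge (le_inv_of_le_inv hx.le) fun h =>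
        hx.not_ge (inv_le_of_inv_le h)
      rcases (inv_le_of_inv_le hsx).eq_or_lt with h2 | h2
      · exact (h2 ▸ (inv_inv x)).ge
      · exact (hrs.2 h1 h2).elim
  refine ⟨O, ⟨hO, isConsistent_of_isLowerSet hτ hO hl, fun x hx => ?_⟩, hr, hs⟩
  by_cases hxr : x ≤ r
  · exact ⟨r, hr, hxr⟩
  by_cases hxs : x ≤ inv s
  · exact ⟨inv s, hs, hxs⟩
  -- The strict condition `x < inv r` could fail for suprema of chains in `O`. Above this `x`,
  -- however, chains stay below `s`, so a supremum `inv r` would put both `r` and `inv r` below `s`.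
  -- Hence Zorn's lemma applies.
  have key : ∀ y ∈ O, x ≤ y → y ≤ s ∧ y ≤ inv r := by
    intro y hy hxy
    refine ⟨?_, (hy.resolve_left fun h => hxr (hxy.trans h)).le⟩
    rcases hτ.nested y s with h | h | h | h
    · exact h
    · exact (hxs (hxy.trans h)).elim
    · exact (hxs (hxy.trans (hs.2 hy (inv_le_of_inv_le h)))).elim
    · exact (hO.not_inv_mem hτ (hl (le_of_inv_le_inv h) hy) hs.prop).elim
  obtain ⟨m, hxm, hm⟩ := zorn_le_nonempty₀ (O ∩ Set.Ici x) (fun c hcO hc y hy => by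
    obtain ⟨b, hb⟩ := hcc c ⟨y, hy⟩ hc
    have hbs : b ≤ s := hb.2 fun z hz => (key z (hcO hz).1 (hcO hz).2).1
    have hbr : b ≤ inv r := hb.2 fun z hz => (key z (hcO hz).1 (hcO hz).2).2
    refine ⟨b, ⟨Or.inr (lt_of_le_of_ne hbr ?_), (hcO hy).2.trans (hb.1 hy)⟩, fun z hz => hb.1 hz⟩
    rintro rfl
    exact hτ.not_le_inv_le hreg hrs.le hbs) x ⟨hx, le_rfl⟩
  exact ⟨m, ⟨hm.prop.1, fun y hy hmy => hm.le_of_ge ⟨hy, hxm.trans hmy⟩ hmy⟩, hxm⟩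

theorem IsCompactlyOrdered.isSplittable (hτ : IsTreeSet S) (hreg : IsRegular S) {ι : Type*}
    {X : ι → Type*} [∀ i, PartialOrder (X i)] {π : ∀ i, S → X i} (h : IsCompactlyOrdered S π)
    (hcc : IsChainComplete S) : IsSplittable S := by
  intro r s hrs
  obtain ⟨r', s', hr, hcov, hs⟩ := h.exists_covBy (hreg.sLt_iff_lt.1 hrs) fun x hx y hy _ =>
    hτ.le_or_le hreg hx.1 hy.1 hx.2 hy.2
  obtain ⟨O, hO, hr', hs'⟩ := hcc.isSplitOrientation_of_covBy hτ hreg hcov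
  exact ⟨_, hO.isSplittingStar hτ hreg, r', s', hr', hs', hr, hreg.sLt_iff_lt.2 hcov.lt, hs⟩

end Profinite

end SeparationSystem

theorem mainTheorem3 {τ : Type u} [SeparationSystem τ]
    (hτ : SeparationSystem.IsTreeSet τ) (hreg : SeparationSystem.IsRegular τ) :
    SeparationSystem.IsProfinite τ ↔
      SeparationSystem.IsChainComplete τ ∧ SeparationSystem.IsSplittable τ ∧
        SeparationSystem.IsStarFinite τ := by
  constructor
  · intro h
    obtain ⟨ι, X, _, π, hπ⟩ := h.exists_isCompactlyOrdered
    have hcc : SeparationSystem.IsChainComplete τ := fun C hne hC =>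
      (hπ.exists_isLUB hne hC).imp fun _ => And.left
    exact ⟨hcc, hπ.isSplittable hτ hreg hcc, hπ.isStarFinite hreg⟩
  · rintro ⟨hcc, hsp, hsf⟩
    exact SeparationSystem.isProfinite_of_isChainComplete hτ hreg hcc hsp hsf
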